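/- **The pedal porism.** Let $\mathcal T$ be a (nondegenerate) triangle in the Euclidean plane with circumcircle $\mathcal C$, and let $D$ be a point lying neither on a side line of $\mathcal T$ nor on $\mathcal C$. For a triangle $\mathcal T'$ whose three feet of the perpendiculars from $D$ to its side lines are not collinear, the pedal circle of $\mathcal T'$ (with respect to $D$) is the circle through these three feet. "Side" always means the line through two vertices. A line is tangent to a nondegenerate conic if it is tangent to it at a point of its projective closure (so the asymptotes of a hyperbola count as tangents), and a triangle is circumscribed to a conic if its three sides are tangent to it. Then the pedal circle $\mathcal E_D$ of $\mathcal T$ exists, there is exactly one nondegenerate conic $\gamma_D$ having $D$ as a focus (a circle has its centre as focus) to which $\mathcal T$ is circumscribed (the inconic of $\mathcal T$ focused at $D$), and the following hold. 1. $(\mathcal C,\gamma_D)$ is a Poncelet pair for $n=3$: there is a triangle inscribed in $\mathcal C$ and circumscribed to $\gamma_D$; and whenever two different tangents to $\gamma_D$ through a point $P\in\mathcal C$ meet $\mathcal C$ again in points $Q\ne P$ and $R\ne P$, respectively, the points $P,Q,R$ are the vertices of a triangle circumscribed to $\gamma_D$. 2. A triangle inscribed in $\mathcal C$ has pedal circle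 $\mathcal E_D$ with respect to $D$ if and only if it is circumscribed to $\gamma_D$. 3. Construction of all these triangles. Let $P\in\mathcal C$, and suppose that the circle with diameter $[PD]$ meets $\mathcal E_D$ in two different points $X,Y$ and that the lines $PX$, $PY$ meet $\mathcal C$ again in points $Q\neq P$ and $R\ne P$, respectively (if $X=P$, the line $PX$ is understood as the tangent at $P$ to the circle with diameter $[PD]$, and likewise for $Y$). Then the line $QR$ is tangent to $\gamma_D$, the foot of the perpendicular from $D$ to $QR$ lies on $\mathcal E_D$, and $PQR$ is a triangle inscribed in $\mathcal C$, circumscribed to $\gamma_D$ and with pedal circle $\mathcal E_D$. Conversely, every triangle inscribed in $\mathcal C$ and circumscribed to $\gamma_D$ is obtained in this way, starting from any of its vertices $P$. -/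

import Mathlib

open scoped Matrix

/-- The Euclidean plane. -/
abbrev Plane : Type := EuclideanSpace ℝ (Fin 2)

/-- Homogeneous coordinates `(x : y : 1)` of a point of the plane. -/
def homCoord (P : Plane) : Fin 3 → ℝ := ![P 0, P 1, 1]

/-- A nondegenerate conic of the projective plane, given by an equation `vᵀ M v = 0` with `M` an
invertible symmetric matrix. Proportional matrices give the same conic. -/
structure Conic where
  mat : Matrix (Fin 3) (Fin 3) ℝ
  symm : mat.IsSymm
  det_ne_zero : mat.det ≠ 0

namespace Conic

/-- Two equations define the same conic. -/
def Same (γ γ' : Conic) : Prop := ∃ c : ℝ, c ≠ 0 ∧ γ'.mat = c • γ.mat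

/-- The left-hand side of the affine equation of the conic. -/
def eqn (γ : Conic) (P : Plane) : ℝ := homCoord P ⬝ᵥ (γ.mat *ᵥ homCoord P)

/-- `ℓ` is a tangent line: it is the polar line `{w | vᵀ M w = 0}` of a point `v` of the projective
conic. The point of contact may be at infinity, so the asymptotes of a hyperbola are tangents. -/
def IsTangentLine (γ : Conic) (ℓ : AffineSubspace ℝ Plane) : Prop :=
  ∃ v : Fin 3 → ℝ, v ≠ 0 ∧ v ⬝ᵥ (γ.mat *ᵥ v) = 0 ∧
    ∀ P : Plane, P ∈ ℓ ↔ v ⬝ᵥ (γ.mat *ᵥ homCoord P) = 0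

/-- `F` is a focus: up to a scalar, the equation of the conic is the focus-directrix equation
`dist P F ^ 2 = (⟪u, P⟫ + k) ^ 2`. If `u ≠ 0` the directrix is the line `⟪u, P⟫ + k = 0`, which does
not contain `F`, and the eccentricity is `‖u‖`, because `|⟪u, P⟫ + k|` is `‖u‖` times the distance
from `P` to that line; if `u = 0` the conic is the circle with centre `F` and radius `|k| > 0`. -/
def IsFocus (γ : Conic) (F : Plane) : Prop :=
  ∃ (c : ℝ) (u : Plane) (k : ℝ), c ≠ 0 ∧ inner ℝ u F + k ≠ 0 ∧
    ∀ P : Plane, γ.eqn P = c * (dist P F ^ 2 - (inner ℝ u P + k) ^ 2)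

end Conic

/-- The side line of the triangle opposite to the vertex `i`. -/
noncomputable def sideLine (T : Affine.Triangle ℝ Plane) (i : Fin 3) : AffineSubspace ℝ Plane :=
  line[ℝ, T.points (i + 1), T.points (i + 2)]

/-- The foot of the perpendicular from `D` to the line through `A` and `B`. -/
noncomputable def footOn (D A B : Plane) : Plane :=
  (EuclideanGeometry.orthogonalProjection line[ℝ, A, B] D : Plane)

/-- The vertices of the pedal triangle of `T` with respect to `D`. -/
noncomputable def pedalPoints (D : Plane) (T : Affine.Triangle ℝ Plane) : Fin 3 → Plane :=
  fun i => footOn D (T.points (i + 1)) (T.points (i + 2))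

/-- `E` is the circumcircle of the (nondegenerate) pedal triangle of `T` with respect to `D`. -/
def IsPedalCircle (D : Plane) (T : Affine.Triangle ℝ Plane)
    (E : EuclideanGeometry.Sphere Plane) : Prop :=
  ∃ h : AffineIndependent ℝ (pedalPoints D T),
    (Affine.Simplex.mk (n := 2) (pedalPoints D T) h).circumsphere = E

/-- The triangle is inscribed in the circle. -/
def IsInscribedIn (T : Affine.Triangle ℝ Plane) (C : EuclideanGeometry.Sphere Plane) : Prop :=
  ∀ i, T.points i ∈ C

/-- The triangle is circumscribed to the conic: its side lines are tangents of the conic. -/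
def IsCircumscribedTo (T : Affine.Triangle ℝ Plane) (γ : Conic) : Prop :=
  ∀ i, γ.IsTangentLine (sideLine T i)

/-- `γ` is an inconic of `T` with focus `D`. -/
def IsInconicWithFocus (γ : Conic) (T : Affine.Triangle ℝ Plane) (D : Plane) : Prop :=
  γ.IsFocus D ∧ IsCircumscribedTo T γ

/-- `(C, γ)` is a Poncelet (poristic) pair for `n = 3`: some triangle is inscribed in `C` and
circumscribed to `γ`, and the construction closes up after three steps from every starting point:
if two different tangents to `γ` through a point `P` of `C` meet `C` again in `Q` and `R`, then
`P`, `Q`, `R` are the vertices of a triangle circumscribed to `γ`. -/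
def IsPonceletPairThree (C : EuclideanGeometry.Sphere Plane) (γ : Conic) : Prop :=
  (∃ T : Affine.Triangle ℝ Plane, IsInscribedIn T C ∧ IsCircumscribedTo T γ) ∧
  ∀ (P Q R : Plane) (ℓ₁ ℓ₂ : AffineSubspace ℝ Plane),
    P ∈ C → Q ∈ C → R ∈ C →
    γ.IsTangentLine ℓ₁ → γ.IsTangentLine ℓ₂ → ℓ₁ ≠ ℓ₂ →
    P ∈ ℓ₁ → P ∈ ℓ₂ → Q ∈ ℓ₁ → R ∈ ℓ₂ → Q ≠ P → R ≠ P →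
    ∃ T : Affine.Triangle ℝ Plane, T.points = ![P, Q, R] ∧ IsCircumscribedTo T γ

open Classical in
/-- For a point `X` of the circle with diameter `[PD]`, the line `PX`; in the limiting case `X = P`
this is the tangent to that circle at `P`. -/
noncomputable def lineFrom (D P X : Plane) : AffineSubspace ℝ Plane :=
  if X = P then (EuclideanGeometry.Sphere.ofDiameter P D).orthRadius P else line[ℝ, P, X]

/-- The triple `P, Q, R` is produced by the pedal construction started at the point `P` of the
circle `C`: the circle with diameter `[PD]` meets `E` in two different points `X`, `Y`, and the
lines `PX`, `PY` meet `C` again in `Q` and `R`. -/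
def IsPedalConstruction (C E : EuclideanGeometry.Sphere Plane) (D P Q R : Plane) : Prop :=
  P ∈ C ∧ ∃ X Y : Plane, X ≠ Y ∧
    X ∈ E ∧ X ∈ EuclideanGeometry.Sphere.ofDiameter P D ∧
    Y ∈ E ∧ Y ∈ EuclideanGeometry.Sphere.ofDiameter P D ∧
    Q ∈ C ∧ Q ≠ P ∧ Q ∈ lineFrom D P X ∧
    R ∈ C ∧ R ≠ P ∧ R ∈ lineFrom D P Y

/-! Take `C` as the unit circle and let `d` be the coordinate of `D`. For a triangle `xyz` on it,
the equation `TripleRel` determines a point `μ`, the other focus of the inconic. The pedal circle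
`E` has centre `(d + μ)/2` and radius `|1 - d conj μ|/2`, and the foot of `D` on the chord `xy` lies
on `E` exactly when `ChordRel` holds.

The porism is Vieta's formulas: for fixed `x`, `ChordRel d μ x y` is a quadratic equation in `y`,
and its two roots `y`, `z` satisfy `TripleRel`. That relation is symmetric in `x`, `y`, `z`, so it
also yields `ChordRel` for `y` and `z`. Hence two chords from `P` with feet on `E` always close up
to a triangle with all its feet on `E` (`exists_sphere_forall_footOn_mem`).

The conic enters through its pedal curve: the affine tangents of a conic with focus `D` are the
perpendiculars to `XD` at the points `X` satisfying `PedalEq`. Every circle avoiding `D` is such a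
curve, and three noncollinear points of it determine the conic. So tangency to the inconic means
that the foot lies on `E`. By Thales, intersecting `E` with the circle on `[PD]` gives the feet on
the tangents through `P`. -/

open ComplexConjugate

/-! ### Algebra of triangles on the unit circle -/

namespace UnitCircle

variable {d μ x y z : ℂ}

/-- The relation satisfied by chords `xy` of the unit circle tangent to the conic with foci `d` and `μ`. -/
def ChordRel (d μ x y : ℂ) : Prop :=
  (x + y - x * y * conj d - μ) * (x + y - d - x * y * conj μ)
    = (1 - d * conj μ) * (1 - conj d * μ) * (x * y)

/-- The triangle `xyz` has the isogonally conjugate points `d` and `μ`. -/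
def TripleRel (d μ x y z : ℂ) : Prop :=
  x + y + z = d + μ + conj d * conj μ * (x * y * z)

theorem one_sub_conj_mul_ne_zero (hx : x * conj x = 1) (hd : d * conj d ≠ 1) :
    1 - x * conj d ≠ 0 := by
  intro h
  apply hd
  have h' := congrArg conj h
  simp only [map_sub, map_one, map_mul, Complex.conj_conj, map_zero] at h'
  linear_combination (-x * conj d) * h' + (-1 : ℂ) * h - d * conj d * hx

/-- This is the conjugate of the relation, multiplied by `xyz`, because conjugation inverts points
of the unit circle. Together the two relations give the elementary symmetric functions of `x`, `y`,
`z`. -/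
theorem TripleRel.conj_eq (hx : x * conj x = 1) (hy : y * conj y = 1) (hz : z * conj z = 1)
    (h : TripleRel d μ x y z) :
    x * y + x * z + y * z = (conj d + conj μ) * (x * y * z) + d * μ := by
  have h' := congrArg conj h
  simp only [map_add, map_mul, Complex.conj_conj] at h'
  have e : x * y * z * (conj x * conj y * conj z) = 1 := by
    rw [show x * y * z * (conj x * conj y * conj z) =
      (x * conj x) * (y * conj y) * (z * conj z) by ring, hx, hy, hz]; ring
  linear_combination (x * y * z) * h' + d * μ * e - y * z * hx - x * z * hy - x * y * hz

/-- Eliminating `y + z` between the relation and its conjugate leaves only the product `yz`. -/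
theorem TripleRel.root (hx : x * conj x = 1) (hy : y * conj y = 1) (hz : z * conj z = 1)
    (h : TripleRel d μ x y z) :
    (x - d) * (x - μ) = y * z * ((1 - x * conj d) * (1 - x * conj μ)) := by
  have h2 := h.conj_eq hx hy hz
  have hx0 : x ≠ 0 := by rintro rfl; simp at hx
  unfold TripleRel at h
  apply mul_left_cancel₀ hx0
  linear_combination x ^ 2 * h - x * h2

theorem TripleRel.rotate (h : TripleRel d μ x y z) : TripleRel d μ y z x := by
  unfold TripleRel at *
  linear_combination h

theorem TripleRel.chordRel (hx : x * conj x = 1) (hy : y * conj y = 1) (hz : z * conj z = 1)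
    (h : TripleRel d μ x y z) : ChordRel d μ y z := by
  have h2 := h.root hx hy hz
  unfold ChordRel
  have e1 : y + z - y * z * conj d - μ = (d - x) - conj d * (y * z) * (1 - x * conj μ) := by
    unfold TripleRel at h; linear_combination h
  have e2 : y + z - d - y * z * conj μ = (μ - x) - conj μ * (y * z) * (1 - x * conj d) := by
    unfold TripleRel at h; linear_combination h
  rw [e1, e2]
  linear_combination (1 - conj d * conj μ * (y * z)) * h2

/-- Vieta for the quadratic satisfied by the two different second endpoints of chords from `x`. Its
leading coefficient is nonzero because neither `d` nor `μ` lies on the circle. -/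
theorem ChordRel.tripleRel (hx : x * conj x = 1) (hd : d * conj d ≠ 1) (hμ : μ * conj μ ≠ 1)
    (hyz : y ≠ z) (hy : ChordRel d μ x y) (hz : ChordRel d μ x z) : TripleRel d μ x y z := by
  have hA : (1 - x * conj d) * (1 - x * conj μ) ≠ 0 :=
    mul_ne_zero (one_sub_conj_mul_ne_zero hx hd) (one_sub_conj_mul_ne_zero hx hμ)
  unfold ChordRel at hy hz
  have hsum : (1 - x * conj d) * (1 - x * conj μ) * (y + z) +
      ((x - μ) * (1 - x * conj μ) + (x - d) * (1 - x * conj d)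
        - (1 - d * conj μ) * (1 - conj d * μ) * x) = 0 := by
    apply mul_left_cancel₀ (sub_ne_zero.2 hyz)
    linear_combination hy - hz
  have hprod : (1 - x * conj d) * (1 - x * conj μ) * (y * z) = (x - μ) * (x - d) := by
    linear_combination y * hsum - hy
  unfold TripleRel
  apply mul_left_cancel₀ hA
  linear_combination hsum - conj d * conj μ * x * hprod

theorem exists_tripleRel (hx : x * conj x = 1) (hy : y * conj y = 1) (hz : z * conj z = 1)
    (hd : d * conj d ≠ 1) : ∃ μ, TripleRel d μ x y z := by
  have h1 : 1 - d * conj d ≠ 0 := sub_ne_zero.2 hd.symm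
  -- With `s = x + y + z - d`, this solves `μ + conj d * xyz * conj μ = s` together with its
  -- conjugate; as `|xyz| = 1`, the determinant is `1 - |d|²`.
  refine ⟨((x + y + z - d) - conj d * (x * y * z) * conj (x + y + z - d)) / (1 - d * conj d), ?_⟩
  have e : x * y * z * (conj x * conj y * conj z) = 1 := by
    rw [show x * y * z * (conj x * conj y * conj z) =
      (x * conj x) * (y * conj y) * (z * conj z) by ring, hx, hy, hz]; ring
  have h2 : 1 - conj d * d ≠ 0 := by rwa [mul_comm]
  unfold TripleRel
  simp only [map_div₀, map_sub, map_one, map_mul, map_add, Complex.conj_conj]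
  rw [mul_comm (conj d) d]
  field_simp
  linear_combination (d * conj d * (x + y + z - d)) * e

/-- This makes the radius of the pedal circle positive. If `μ` were the inverse of `d` in the
circle, `root` would reduce to `a * d = xyz * conj d` for each vertex `a`, and the vertices would
coincide. -/
theorem TripleRel.one_sub_ne_zero (hx : x * conj x = 1) (hy : y * conj y = 1)
    (hz : z * conj z = 1) (hd : d * conj d ≠ 1) (hxy : x ≠ y)
    (h : TripleRel d μ x y z) : 1 - d * conj μ ≠ 0 := by
  intro h0
  have h0' := congrArg conj h0
  simp only [map_sub, map_one, map_mul, Complex.conj_conj, map_zero] at h0'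
  have hd0 : d ≠ 0 := by rintro rfl; simp at h0
  have key : ∀ {a : ℂ}, a * conj a = 1 → a * ((a - d) * (a - μ)) =
      x * y * z * ((1 - a * conj d) * (1 - a * conj μ)) → a * d = x * y * z * conj d := by
    intro a ha hr
    have n1 := one_sub_conj_mul_ne_zero ha hd
    have n2 : a - d ≠ 0 := by rintro h; rw [sub_eq_zero.1 h] at ha; exact hd ha
    apply mul_left_cancel₀ (mul_ne_zero n1 n2)
    linear_combination (-d * conj d) * hr + (d * a * (a - d)) * h0'
      - x * y * z * conj d * a * (1 - a * conj d) * h0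
  have kx := key hx (by rw [h.root hx hy hz]; ring)
  have ky := key hy (by rw [h.rotate.root hy hz hx]; ring)
  exact hxy (mul_right_cancel₀ hd0 (kx.trans ky.symm))

/-- The second focus is not on the circle unless the first is on a side line. -/
theorem TripleRel.mul_conj_ne_one (hx : x * conj x = 1) (hy : y * conj y = 1)
    (hz : z * conj z = 1)
    (hsx : y + z ≠ d + y * z * conj d) (hsy : z + x ≠ d + z * x * conj d)
    (hsz : x + y ≠ d + x * y * conj d)
    (h : TripleRel d μ x y z) : μ * conj μ ≠ 1 := by
  intro hμ
  have key : ∀ {a b c : ℂ}, TripleRel d μ a b c → b + c ≠ d + b * c * conj d → μ ≠ a := by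
    rintro a b c hr hs rfl
    apply hs
    unfold TripleRel at hr
    linear_combination hr + conj d * b * c * hμ
  have n1 := key h hsx
  have n2 := key h.rotate hsy
  have n3 := key h.rotate.rotate hsz
  have h2 := h.conj_eq hx hy hz
  -- The cubic with roots `x`, `y`, `z` takes the value `xyz (1 - conj d * μ)(|μ|² - 1)` at `μ`, so
  -- `|μ| = 1` would make `μ` a vertex.
  apply mul_ne_zero (mul_ne_zero (sub_ne_zero.2 n1) (sub_ne_zero.2 n2)) (sub_ne_zero.2 n3)
  unfold TripleRel at h
  linear_combination (-μ ^ 2) * h + μ * h2 + x * y * z * (1 - conj d * μ) * hμ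

end UnitCircle

/-! ### Lines and perpendicular feet in real coordinates -/

theorem plane_inner (P Q : Plane) : inner ℝ P Q = P 0 * Q 0 + P 1 * Q 1 := by
  simp [PiLp.inner_apply, Fin.sum_univ_two, mul_comm]

theorem plane_dist_sq (P Q : Plane) : dist P Q ^ 2 = (P 0 - Q 0) ^ 2 + (P 1 - Q 1) ^ 2 := by
  rw [EuclideanSpace.dist_eq, Real.sq_sqrt (by positivity)]
  simp [Fin.sum_univ_two, Real.dist_eq, sq_abs]

theorem plane_ext {P Q : Plane} (h0 : P 0 = Q 0) (h1 : P 1 = Q 1) : P = Q := by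
  ext i; fin_cases i <;> assumption

theorem mem_sphere_iff_sq {E : EuclideanGeometry.Sphere Plane} (hE : 0 ≤ E.radius) (P : Plane) :
    P ∈ E ↔ (P 0 - E.center 0) ^ 2 + (P 1 - E.center 1) ^ 2 = E.radius ^ 2 := by
  rw [EuclideanGeometry.mem_sphere, ← plane_dist_sq, sq_eq_sq₀ dist_nonneg hE]

theorem mem_line_iff {A B : Plane} (h : A ≠ B) (P : Plane) :
    P ∈ line[ℝ, A, B] ↔ (P 0 - A 0) * (B 1 - A 1) = (P 1 - A 1) * (B 0 - A 0) := by
  rw [mem_affineSpan_pair_iff_exists_lineMap_eq]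
  constructor
  · rintro ⟨t, rfl⟩
    simp [AffineMap.lineMap_apply]
    ring
  · intro hP
    have hs : (B 0 - A 0) ^ 2 + (B 1 - A 1) ^ 2 ≠ 0 := by
      rw [← plane_dist_sq]; exact pow_ne_zero _ (dist_ne_zero.2 h.symm)
    refine ⟨((P 0 - A 0) * (B 0 - A 0) + (P 1 - A 1) * (B 1 - A 1)) /
      ((B 0 - A 0) ^ 2 + (B 1 - A 1) ^ 2), ?_⟩
    apply plane_ext
    · simp [AffineMap.lineMap_apply]
      field_simp
      linear_combination (-(B 1 - A 1)) * hP
    · simp [AffineMap.lineMap_apply]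
      field_simp
      linear_combination (B 0 - A 0) * hP

theorem eq_footOn_iff {D A B : Plane} (X : Plane) :
    X = footOn D A B ↔ X ∈ line[ℝ, A, B] ∧
      (X 0 - D 0) * (B 0 - A 0) + (X 1 - D 1) * (B 1 - A 1) = 0 := by
  rw [footOn, eq_comm, EuclideanGeometry.coe_orthogonalProjection_eq_iff_mem,
    direction_affineSpan, vectorSpan_pair_rev, Submodule.mem_orthogonal_singleton_iff_inner_right]
  simp only [vsub_eq_sub, plane_inner, PiLp.sub_apply]
  refine and_congr_right fun _ => ⟨fun h' => ?_, fun h' => ?_⟩ <;> linear_combination -h'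

theorem footOn_comm (D A B : Plane) : footOn D A B = footOn D B A := by
  simp only [footOn, Set.pair_comm A B]

/-- `ℓ` is the line through `X` perpendicular to `XD`. -/
def IsPerpAt (D X : Plane) (ℓ : AffineSubspace ℝ Plane) : Prop :=
  ∀ P : Plane, P ∈ ℓ ↔ (P 0 - X 0) * (X 0 - D 0) + (P 1 - X 1) * (X 1 - D 1) = 0

namespace IsPerpAt

variable {D X Y A B : Plane} {ℓ ℓ' : AffineSubspace ℝ Plane}

theorem self_mem (h : IsPerpAt D X ℓ) : X ∈ ℓ := (h X).2 (by ring)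

theorem eq (h : IsPerpAt D X ℓ) (h' : IsPerpAt D X ℓ') : ℓ = ℓ' := by
  ext P; rw [h P, h' P]

theorem sq_pos (hX : X ≠ D) : 0 < (X 0 - D 0) ^ 2 + (X 1 - D 1) ^ 2 := by
  rw [← plane_dist_sq]; exact pow_pos (dist_pos.2 hX) 2

theorem unique (h : IsPerpAt D X ℓ) (h' : IsPerpAt D Y ℓ) : X = Y := by
  have h1 := (h Y).1 h'.self_mem
  have h2 := (h' X).1 h.self_mem
  have h3 : (X 0 - Y 0) ^ 2 + (X 1 - Y 1) ^ 2 = 0 := by linear_combination -h1 - h2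
  rw [← plane_dist_sq] at h3
  exact dist_eq_zero.1 (pow_eq_zero_iff two_ne_zero |>.1 h3)

theorem eq_line (hX : X ≠ D) (h : IsPerpAt D X ℓ) (hAB : A ≠ B) (hA : A ∈ ℓ) (hB : B ∈ ℓ) :
    ℓ = line[ℝ, A, B] := by
  ext P
  have hs := sq_pos hX
  have hs' := sq_pos hAB.symm
  have hA' := (h A).1 hA
  have hB' := (h B).1 hB
  rw [h P, mem_line_iff hAB]
  constructor
  · intro hP
    apply mul_left_cancel₀ hs.ne'
    linear_combination ((B 1 - A 1) * (X 0 - D 0) - (B 0 - A 0) * (X 1 - D 1)) * (hP - hA')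
      + ((P 1 - A 1) * (X 0 - D 0) - (P 0 - A 0) * (X 1 - D 1)) * (hA' - hB')
  · intro hP
    apply mul_left_cancel₀ hs'.ne'
    linear_combination ((P 0 - A 0) * (B 0 - A 0) + (P 1 - A 1) * (B 1 - A 1)) * (hB' - hA')
      + ((X 0 - D 0) * (B 1 - A 1) - (X 1 - D 1) * (B 0 - A 0)) * hP
      + ((B 0 - A 0) ^ 2 + (B 1 - A 1) ^ 2) * hA'

/-- The foot must differ from `D`: at `X = D` the equation in `IsPerpAt` is vacuous and describes
the whole plane. -/
theorem line_footOn (hAB : A ≠ B) (hX : footOn D A B ≠ D) :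
    IsPerpAt D (footOn D A B) line[ℝ, A, B] := by
  obtain ⟨h1, h2⟩ := (eq_footOn_iff _).1 (rfl : footOn D A B = _)
  generalize footOn D A B = X at *
  intro P
  have hs := sq_pos hX
  have hs' := sq_pos hAB.symm
  rw [mem_line_iff hAB] at h1 ⊢
  constructor
  · intro hP
    apply mul_left_cancel₀ hs'.ne'
    linear_combination ((P 0 - X 0) * (B 0 - A 0) + (P 1 - X 1) * (B 1 - A 1)) * h2
      + ((X 0 - D 0) * (B 1 - A 1) - (X 1 - D 1) * (B 0 - A 0)) * (hP - h1)
  · intro hP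
    apply mul_left_cancel₀ hs.ne'
    linear_combination ((B 1 - A 1) * (X 0 - D 0) - (B 0 - A 0) * (X 1 - D 1)) * hP
      - ((P 1 - X 1) * (X 0 - D 0) - (P 0 - X 0) * (X 1 - D 1)) * h2
      + ((X 0 - D 0) ^ 2 + (X 1 - D 1) ^ 2) * h1

theorem footOn_eq (h : IsPerpAt D X line[ℝ, A, B]) :
    footOn D A B = X := by
  symm
  rw [eq_footOn_iff]
  have hA := (h A).1 (left_mem_affineSpan_pair ℝ A B)
  have hB := (h B).1 (right_mem_affineSpan_pair ℝ A B)
  exact ⟨h.self_mem, by linear_combination hB - hA⟩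

end IsPerpAt

/-! ### Passage to the unit circle -/

/-- The complex coordinate in which the sphere `C` becomes the unit circle. -/
noncomputable def coord (C : EuclideanGeometry.Sphere Plane) (P : Plane) : ℂ :=
  ⟨(P 0 - C.center 0) / C.radius, (P 1 - C.center 1) / C.radius⟩

section Coord

variable {C : EuclideanGeometry.Sphere Plane} {A B D P : Plane}

theorem coord_injective (hC : 0 < C.radius) : Function.Injective (coord C) := by
  intro P Q h
  have h0 := congrArg Complex.re h
  have h1 := congrArg Complex.im h
  simp only [coord] at h0 h1
  apply plane_ext
  · linarith [(div_left_inj' hC.ne').1 h0]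
  · linarith [(div_left_inj' hC.ne').1 h1]

theorem coord_surjective (hC : 0 < C.radius) : Function.Surjective (coord C) := by
  intro z
  refine ⟨!₂[C.center 0 + C.radius * z.re, C.center 1 + C.radius * z.im], ?_⟩
  apply Complex.ext <;> simp [coord, hC.ne']

theorem dist_sq_eq_normSq_coord (hC : 0 < C.radius) (P Q : Plane) :
    dist P Q ^ 2 = C.radius ^ 2 * Complex.normSq (coord C P - coord C Q) := by
  have := hC.ne'
  rw [plane_dist_sq, Complex.normSq_apply]
  simp only [coord, Complex.sub_re, Complex.sub_im]
  field_simp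
  ring

theorem mem_iff_coord (hC : 0 < C.radius) : P ∈ C ↔ coord C P * conj (coord C P) = 1 := by
  rw [mem_sphere_iff_sq hC.le, Complex.mul_conj, ← Complex.ofReal_one, Complex.ofReal_inj,
    Complex.normSq_apply]
  have := hC.ne'
  simp only [coord]
  field_simp

theorem coord_line_eq (hC : 0 < C.radius) (hA : A ∈ C) (hB : B ∈ C) (hAB : A ≠ B)
    (hP : P ∈ line[ℝ, A, B]) :
    coord C P + coord C A * coord C B * conj (coord C P) = coord C A + coord C B := by
  -- Collinearity: the quotient of `P - A` by `B - A` is real.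
  have h1 : (coord C P - coord C A) * conj (coord C B - coord C A) =
      conj ((coord C P - coord C A) * conj (coord C B - coord C A)) := by
    rw [mem_line_iff hAB] at hP
    have := hC.ne'
    apply Complex.ext <;> simp [coord]
    · ring
    · field_simp
      linear_combination -2 * hP
  rw [mem_iff_coord hC] at hA hB
  have hne := sub_ne_zero.2 ((coord_injective hC).ne hAB)
  simp only [map_mul, map_sub, Complex.conj_conj] at h1
  apply mul_left_cancel₀ hne
  linear_combination (coord C A * coord C B) * h1
    - (coord C P - coord C A) * (coord C A * hB - coord C B * hA)
    + (coord C A - coord C B) * coord C B * hA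

/-- With `a`, `b` the endpoints, the chord is `p + ab conj p = a + b` and the perpendicular from `d`
is `p - ab conj p = d - ab conj d`; adding them gives `2p`. -/
theorem coord_footOn (hC : 0 < C.radius) (hA : A ∈ C) (hB : B ∈ C) (hAB : A ≠ B) :
    2 * coord C (footOn D A B) = coord C D + coord C A + coord C B
      - coord C A * coord C B * conj (coord C D) := by
  obtain ⟨h1, h2⟩ := (eq_footOn_iff _).1 (rfl : footOn D A B = _)
  generalize footOn D A B = X at *
  have h3 := coord_line_eq hC hA hB hAB h1
  have h4 : (coord C X - coord C D) * conj (coord C B - coord C A) =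
      - conj ((coord C X - coord C D) * conj (coord C B - coord C A)) := by
    have := hC.ne'
    apply Complex.ext <;> simp [coord]
    · field_simp
      linear_combination 2 * h2
    · ring
  rw [mem_iff_coord hC] at hA hB
  have hne := sub_ne_zero.2 ((coord_injective hC).ne hAB)
  simp only [map_mul, map_sub, Complex.conj_conj] at h4
  apply mul_left_cancel₀ hne
  linear_combination (coord C A * coord C B) * h4
    - (coord C X - coord C D) * (coord C A * hB - coord C B * hA)
    + (coord C A - coord C B) * h3

theorem coord_ne_of_not_mem_line (hC : 0 < C.radius) (hA : A ∈ C) (hB : B ∈ C) (hAB : A ≠ B)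
    (hD : D ∉ line[ℝ, A, B]) : coord C A + coord C B ≠
      coord C D + coord C A * coord C B * conj (coord C D) := by
  intro h
  apply hD
  have h1 := coord_footOn (D := D) hC hA hB hAB
  have h2 : footOn D A B = D := by
    apply coord_injective hC
    apply mul_left_cancel₀ (two_ne_zero (α := ℂ))
    linear_combination h1 + h
  rw [← h2]
  exact ((eq_footOn_iff _).1 rfl).1

theorem mem_sphere_iff_coord (hC : 0 < C.radius) {E : EuclideanGeometry.Sphere Plane} {w : ℂ}
    (hE : E.radius = C.radius * (‖w‖ / 2)) :
    P ∈ E ↔ (2 * coord C P - 2 * coord C E.center) * conj (2 * coord C P - 2 * coord C E.center)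
      = w * conj w := by
  have h0 : 0 ≤ E.radius := by rw [hE]; positivity
  rw [EuclideanGeometry.mem_sphere, ← sq_eq_sq₀ dist_nonneg h0, dist_sq_eq_normSq_coord hC, hE,
    mul_pow, mul_right_inj' (pow_ne_zero 2 hC.ne'), div_pow, Complex.sq_norm, Complex.mul_conj,
    Complex.mul_conj, Complex.ofReal_inj, ← mul_sub, Complex.normSq_mul, Complex.normSq_ofNat]
  constructor <;> intro h <;> linarith

/-- For `x`, `y` on the unit circle, the second factor in `ChordRel` is `xy` times the conjugate of
the first, so `ChordRel` is the equation of `E` at the foot, multiplied by `xy`. -/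
theorem footOn_mem_iff_chordRel (hC : 0 < C.radius) {E : EuclideanGeometry.Sphere Plane} {μ : ℂ}
    (hcen : 2 * coord C E.center = coord C D + μ)
    (hE : E.radius = C.radius * (‖1 - coord C D * conj μ‖ / 2))
    (hA : A ∈ C) (hB : B ∈ C) (hAB : A ≠ B) :
    footOn D A B ∈ E ↔ UnitCircle.ChordRel (coord C D) μ (coord C A) (coord C B) := by
  rw [mem_sphere_iff_coord hC hE, hcen, coord_footOn hC hA hB hAB]
  rw [mem_iff_coord hC] at hA hB
  unfold UnitCircle.ChordRel
  have hA0 : coord C A ≠ 0 := by intro h; simp [h] at hA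
  have hB0 : coord C B ≠ 0 := by intro h; simp [h] at hB
  rw [← mul_left_inj' (mul_ne_zero hA0 hB0)]
  simp only [map_sub, map_add, map_mul, map_one, Complex.conj_conj]
  generalize coord C A = x, coord C B = y, coord C D = d at *
  have e : (conj d + conj x + conj y - conj x * conj y * d - (conj d + conj μ)) * (x * y) =
      x + y - d - x * y * conj μ := by
    linear_combination (y - d * y * conj y) * hA + (x - d) * hB
  constructor <;> intro h
  · linear_combination h - (x + y - x * y * conj d - μ) * e
  · linear_combination h + (x + y - x * y * conj d - μ) * e

end Coord

/-- The pedal circle of a triangle, with the closure property of the chords of the circumcircle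
whose feet lie on it. -/
theorem exists_sphere_forall_footOn_mem (T : Affine.Triangle ℝ Plane) (D : Plane)
    (hside : ∀ i, D ∉ sideLine T i) (hcirc : D ∉ T.circumsphere) :
    ∃ E : EuclideanGeometry.Sphere Plane, 0 < E.radius ∧ D ∉ E ∧
      (∀ i, footOn D (T.points (i + 1)) (T.points (i + 2)) ∈ E) ∧
      ∀ P Q R : Plane, P ∈ T.circumsphere → Q ∈ T.circumsphere → R ∈ T.circumsphere →
        P ≠ Q → P ≠ R → Q ≠ R → footOn D P Q ∈ E → footOn D P R ∈ E → footOn D Q R ∈ E := by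
  have hC : 0 < T.circumsphere.radius := T.circumradius_pos
  have hT : ∀ i, T.points i ∈ T.circumsphere := T.mem_circumsphere
  have hne : ∀ {i j}, i ≠ j → T.points i ≠ T.points j := fun h => T.independent.injective.ne h
  generalize T.circumsphere = C at *
  have hs0 := coord_ne_of_not_mem_line hC (hT 1) (hT 2) (hne (by decide)) (hside 0)
  have hs1 := coord_ne_of_not_mem_line hC (hT 2) (hT 0) (hne (by decide)) (hside 1)
  have hs2 := coord_ne_of_not_mem_line hC (hT 0) (hT 1) (hne (by decide)) (hside 2)
  have hd := (mem_iff_coord hC).not.1 hcirc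
  have hu := fun i => (mem_iff_coord hC).1 (hT i)
  obtain ⟨μ, hμ⟩ := UnitCircle.exists_tripleRel (hu 0) (hu 1) (hu 2) hd
  have hμ1 := hμ.mul_conj_ne_one (hu 0) (hu 1) (hu 2) hs0 hs1 hs2
  have hr := hμ.one_sub_ne_zero (hu 0) (hu 1) (hu 2) hd ((coord_injective hC).ne (hne (by decide)))
  obtain ⟨m, hm⟩ := coord_surjective hC ((coord C D + μ) / 2)
  have hE : (⟨m, C.radius * (‖1 - coord C D * conj μ‖ / 2)⟩ :
    EuclideanGeometry.Sphere Plane).radius = C.radius * (‖1 - coord C D * conj μ‖ / 2) := rfl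
  have hcen : 2 * coord C (⟨m, C.radius * (‖1 - coord C D * conj μ‖ / 2)⟩ :
    EuclideanGeometry.Sphere Plane).center = coord C D + μ := by
    simp only [hm]; ring
  refine ⟨⟨m, C.radius * (‖1 - coord C D * conj μ‖ / 2)⟩, ?_, ?_, ?_, ?_⟩
  · exact mul_pos hC (by positivity)
  · rw [mem_sphere_iff_coord hC hE, hcen]
    intro h
    simp only [map_sub, map_add, map_mul, map_one, map_ofNat, Complex.conj_conj] at h
    -- The power of `D` is governed by `|1 - d conj μ|² - |d - μ|² = (1 - |d|²)(1 - |μ|²)`.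
    apply mul_ne_zero (sub_ne_zero.2 hd) (sub_ne_zero.2 hμ1)
    linear_combination -h
  · intro i
    rw [footOn_mem_iff_chordRel hC hcen hE (hT _) (hT _) (hne (by fin_cases i <;> decide))]
    fin_cases i
    · exact hμ.chordRel (hu 0) (hu 1) (hu 2)
    · exact hμ.rotate.chordRel (hu 1) (hu 2) (hu 0)
    · exact hμ.rotate.rotate.chordRel (hu 2) (hu 0) (hu 1)
  · intro P Q R hP hQ hR hPQ hPR hQR h1 h2
    rw [footOn_mem_iff_chordRel hC hcen hE] at h1 h2 ⊢ <;> try assumption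
    have hyz := (coord_injective hC).ne hQR
    rw [mem_iff_coord hC] at hP hQ hR
    exact (h1.tripleRel hP hd hμ1 hyz h2).chordRel hP hQ hR

/-! ### Conics with a given focus and their tangents -/

/-- The matrix of the equation `dist P D ^ 2 = (⟪u, P⟫ + k) ^ 2`. -/
def focusMatrix (D u : Plane) (k : ℝ) : Matrix (Fin 3) (Fin 3) ℝ :=
  !![1 - u 0 ^ 2, -(u 0 * u 1), -(D 0) - k * u 0;
     -(u 0 * u 1), 1 - u 1 ^ 2, -(D 1) - k * u 1;
     -(D 0) - k * u 0, -(D 1) - k * u 1, D 0 ^ 2 + D 1 ^ 2 - k ^ 2]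

theorem focusMatrix_isSymm (D u : Plane) (k : ℝ) : (focusMatrix D u k).IsSymm := by
  ext i j
  fin_cases i <;> fin_cases j <;> simp [focusMatrix]

theorem det_focusMatrix (D u : Plane) (k : ℝ) :
    (focusMatrix D u k).det = -(u 0 * D 0 + u 1 * D 1 + k) ^ 2 := by
  simp only [focusMatrix, Matrix.det_fin_three, Matrix.of_apply, Matrix.cons_val', Matrix.cons_val]
  ring

theorem focusMatrix_neg (D u : Plane) (k : ℝ) : focusMatrix D (-u) (-k) = focusMatrix D u k := by
  simp [focusMatrix]

theorem dotProduct_focusMatrix_mulVec (D u : Plane) (k : ℝ) (v w : Fin 3 → ℝ) :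
    v ⬝ᵥ (focusMatrix D u k *ᵥ w) =
      (v 0 - v 2 * D 0) * (w 0 - w 2 * D 0) + (v 1 - v 2 * D 1) * (w 1 - w 2 * D 1)
        - (u 0 * v 0 + u 1 * v 1 + k * v 2) * (u 0 * w 0 + u 1 * w 1 + k * w 2) := by
  simp only [focusMatrix, Matrix.mulVec, dotProduct, Fin.sum_univ_three, Matrix.of_apply,
    Matrix.cons_val', Matrix.cons_val]
  ring

/-- The six affine points used in the proof lie on no common conic, so they determine all six
coefficients. -/
theorem Matrix.IsSymm.ext_of_homCoord {M N : Matrix (Fin 3) (Fin 3) ℝ} (hM : M.IsSymm)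
    (hN : N.IsSymm)
    (h : ∀ P : Plane, homCoord P ⬝ᵥ (M *ᵥ homCoord P) = homCoord P ⬝ᵥ (N *ᵥ homCoord P)) :
    M = N := by
  have key : ∀ x y : ℝ, homCoord !₂[x, y] = ![x, y, 1] := fun x y => by simp [homCoord]
  have h1 := h !₂[0, 0]
  have h2 := h !₂[1, 0]
  have h3 := h !₂[-1, 0]
  have h4 := h !₂[0, 1]
  have h5 := h !₂[0, -1]
  have h6 := h !₂[1, 1]
  simp only [key, Matrix.mulVec, dotProduct, Fin.sum_univ_three, Matrix.cons_val]
    at h1 h2 h3 h4 h5 h6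
  have m1 := hM.apply 0 1
  have m2 := hM.apply 0 2
  have m3 := hM.apply 1 2
  have n1 := hN.apply 0 1
  have n2 := hN.apply 0 2
  have n3 := hN.apply 1 2
  ext i j
  fin_cases i <;> fin_cases j <;> simp only [Fin.mk_zero, Fin.mk_one, Fin.reduceFinMk, Fin.isValue] <;> linarith

theorem Conic.eqn_eq_of_mat {γ : Conic} {D u : Plane} {c k : ℝ}
    (h : γ.mat = c • focusMatrix D u k) (P : Plane) :
    γ.eqn P = c * (dist P D ^ 2 - (inner ℝ u P + k) ^ 2) := by
  rw [Conic.eqn, h, Matrix.smul_mulVec, dotProduct_smul, dotProduct_focusMatrix_mulVec,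
    plane_dist_sq, plane_inner, smul_eq_mul]
  simp only [homCoord, Matrix.cons_val]
  ring

theorem Conic.isFocus_iff {γ : Conic} {D : Plane} :
    γ.IsFocus D ↔ ∃ (c : ℝ) (u : Plane) (k : ℝ), c ≠ 0 ∧ u 0 * D 0 + u 1 * D 1 + k ≠ 0 ∧
      γ.mat = c • focusMatrix D u k := by
  constructor
  · rintro ⟨c, u, k, hc, hk, h⟩
    rw [plane_inner] at hk
    refine ⟨c, u, k, hc, hk, γ.symm.ext_of_homCoord ((focusMatrix_isSymm D u k).smul c) fun P => ?_⟩
    have h1 := h P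
    rw [Conic.eqn] at h1
    rw [h1, Matrix.smul_mulVec, dotProduct_smul, dotProduct_focusMatrix_mulVec,
      plane_dist_sq, plane_inner, smul_eq_mul]
    simp only [homCoord, Matrix.cons_val]
    ring
  · rintro ⟨c, u, k, hc, hk, h⟩
    exact ⟨c, u, k, hc, by rwa [plane_inner], Conic.eqn_eq_of_mat h⟩

/-- The equation of the pedal curve with respect to `D` of the conic
`dist P D ^ 2 = (⟪u, P⟫ + k) ^ 2`; here `e = ⟪u, D⟫ + k`. -/
def PedalEq (D u : Plane) (e : ℝ) (X : Plane) : Prop :=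
  e ^ 2 + 2 * e * (u 0 * (X 0 - D 0) + u 1 * (X 1 - D 1))
    = (1 - u 0 ^ 2 - u 1 ^ 2) * ((X 0 - D 0) ^ 2 + (X 1 - D 1) ^ 2)

section Tangent

variable {γ : Conic} {D u : Plane} {c k : ℝ} {ℓ : AffineSubspace ℝ Plane}

theorem Conic.isTangentLine_iff_of_mat (hc : c ≠ 0) (h : γ.mat = c • focusMatrix D u k) :
    γ.IsTangentLine ℓ ↔ ∃ v : Fin 3 → ℝ, v ≠ 0 ∧
      (v 0 - v 2 * D 0) ^ 2 + (v 1 - v 2 * D 1) ^ 2 = (u 0 * v 0 + u 1 * v 1 + k * v 2) ^ 2 ∧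
      ∀ P : Plane, P ∈ ℓ ↔
        (v 0 - v 2 * D 0) * (P 0 - D 0) + (v 1 - v 2 * D 1) * (P 1 - D 1)
          = (u 0 * v 0 + u 1 * v 1 + k * v 2) * (u 0 * P 0 + u 1 * P 1 + k) := by
  unfold Conic.IsTangentLine
  simp only [h, Matrix.smul_mulVec, dotProduct_smul, smul_eq_mul, mul_eq_zero, hc, false_or,
    dotProduct_focusMatrix_mulVec, homCoord, Matrix.cons_val, one_mul, mul_one, sub_eq_zero, ← sq]

theorem Conic.IsTangentLine.exists_isPerpAt (hc : c ≠ 0) (h : γ.mat = c • focusMatrix D u k)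
    (hk : u 0 * D 0 + u 1 * D 1 + k ≠ 0) (hℓ : γ.IsTangentLine ℓ) {A : Plane} (hA : A ∈ ℓ) :
    ∃ X, X ≠ D ∧ IsPerpAt D X ℓ ∧ PedalEq D u (u 0 * D 0 + u 1 * D 1 + k) X := by
  obtain ⟨v, hv, hq, hP⟩ := (Conic.isTangentLine_iff_of_mat hc h).1 hℓ
  generalize he : u 0 * D 0 + u 1 * D 1 + k = e at *
  set s := u 0 * v 0 + u 1 * v 1 + k * v 2 with hs
  -- If `s = 0`, the contact point would be a multiple of the homogeneous coordinates of `D`, but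
  -- the focus is not on the directrix.
  have hs0 : s ≠ 0 := by
    intro h0
    rw [h0] at hq
    have h1 : v 0 - v 2 * D 0 = 0 := by nlinarith
    have h2 : v 1 - v 2 * D 1 = 0 := by nlinarith
    have h3 : v 2 * e = 0 := by linear_combination h0 - hs - u 0 * h1 - u 1 * h2 - v 2 * he
    have h4 : v 2 = 0 := (mul_eq_zero.1 h3).resolve_right hk
    apply hv
    funext i
    fin_cases i
    · simpa [h4] using h1
    · simpa [h4] using h2
    · exact h4
  clear_value s
  obtain ⟨n0, hn0⟩ : ∃ n, n = v 0 - v 2 * D 0 - s * u 0 := ⟨_, rfl⟩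
  obtain ⟨n1, hn1⟩ : ∃ n, n = v 1 - v 2 * D 1 - s * u 1 := ⟨_, rfl⟩
  have hP' : ∀ P : Plane, P ∈ ℓ ↔ n0 * (P 0 - D 0) + n1 * (P 1 - D 1) = s * e := by
    intro P
    rw [hP P, hn0, hn1, ← he]
    constructor <;> intro h <;> linear_combination h
  have hA' := (hP' A).1 hA
  have hse := mul_ne_zero hs0 hk
  -- A zero normal would mean the line at infinity, a tangent of every parabola; the affine point
  -- `A` rules it out.
  have hN : n0 ^ 2 + n1 ^ 2 ≠ 0 := by
    intro h0
    have h1 : n0 = 0 := by nlinarith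
    have h2 : n1 = 0 := by nlinarith
    apply hse
    rw [← hA', h1, h2]; ring
  have hq' : (n0 + s * u 0) ^ 2 + (n1 + s * u 1) ^ 2 = s ^ 2 := by
    rw [← hq, hn0, hn1]; ring
  refine ⟨!₂[D 0 + s * e * n0 / (n0 ^ 2 + n1 ^ 2), D 1 + s * e * n1 / (n0 ^ 2 + n1 ^ 2)],
    ?_, ?_, ?_⟩
  · intro hX
    have h0 := congrArg (fun P : Plane => P 0) hX
    have h1 := congrArg (fun P : Plane => P 1) hX
    simp [hN, hs0, hk] at h0 h1
    rw [h0, h1] at hN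
    simp at hN
  · intro P
    rw [hP' P]
    simp only [Matrix.cons_val]
    constructor
    · intro hl
      field_simp
      linear_combination s * e * (n0 ^ 2 + n1 ^ 2) * hl
    · intro hl
      field_simp at hl
      apply mul_left_cancel₀ (mul_ne_zero hse hN)
      linear_combination hl
  · simp only [PedalEq, Matrix.cons_val]
    field_simp
    linear_combination e ^ 2 * (n0 ^ 2 + n1 ^ 2) * hq'

theorem Conic.isTangentLine_of_isPerpAt (hc : c ≠ 0) (h : γ.mat = c • focusMatrix D u k)
    (hk : u 0 * D 0 + u 1 * D 1 + k ≠ 0) {X : Plane} (hX : X ≠ D) (hℓ : IsPerpAt D X ℓ)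
    (hp : PedalEq D u (u 0 * D 0 + u 1 * D 1 + k) X) : γ.IsTangentLine ℓ := by
  rw [Conic.isTangentLine_iff_of_mat hc h]
  generalize he : u 0 * D 0 + u 1 * D 1 + k = e at *
  have hN := (IsPerpAt.sq_pos hX).ne'
  unfold PedalEq at hp
  unfold IsPerpAt at hℓ
  obtain ⟨f0, hf0⟩ : ∃ f, f = X 0 - D 0 := ⟨_, rfl⟩
  obtain ⟨f1, hf1⟩ : ∃ f, f = X 1 - D 1 := ⟨_, rfl⟩
  rw [← hf0, ← hf1] at hN hp
  -- The contact point is sought as `(y + tD : t)`, scaled so that `⟪u, v⟫ + k v₂ = 1`. The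
  -- direction of the perpendicular forces `y = e f / |f|² + u`, and `PedalEq` says exactly that
  -- `|y| = 1`. The scaling then fixes `t`; `t = 0` is a contact point at infinity.
  obtain ⟨y0, hy0⟩ : ∃ y, y = e * f0 / (f0 ^ 2 + f1 ^ 2) + u 0 := ⟨_, rfl⟩
  obtain ⟨y1, hy1⟩ : ∃ y, y = e * f1 / (f0 ^ 2 + f1 ^ 2) + u 1 := ⟨_, rfl⟩
  obtain ⟨t, ht⟩ : ∃ t, t = (1 - u 0 * y0 - u 1 * y1) / e := ⟨_, rfl⟩
  have hy : y0 ^ 2 + y1 ^ 2 = 1 := by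
    rw [hy0, hy1]
    field_simp
    linear_combination (f0 ^ 2 + f1 ^ 2) * hp
  have hte : t * e = 1 - u 0 * y0 - u 1 * y1 := by rw [ht]; field_simp
  have hs : u 0 * (y0 + t * D 0) + u 1 * (y1 + t * D 1) + k * t = 1 := by
    linear_combination hte + t * he
  refine ⟨![y0 + t * D 0, y1 + t * D 1, t], ?_, ?_, ?_⟩
  · intro h0
    have h1 := congrFun h0 0
    have h2 := congrFun h0 1
    have h3 := congrFun h0 2
    simp only [Matrix.cons_val, Pi.zero_apply] at h1 h2 h3
    rw [h1, h2, h3] at hs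
    simp at hs
  · simp only [Matrix.cons_val, hs]
    linear_combination hy
  · intro P
    simp only [Matrix.cons_val, hs]
    rw [hℓ P, ← hf0, ← hf1]
    have e1 : (y0 - u 0) * (f0 ^ 2 + f1 ^ 2) = e * f0 := by rw [hy0]; field_simp; ring
    have e2 : (y1 - u 1) * (f0 ^ 2 + f1 ^ 2) = e * f1 := by rw [hy1]; field_simp; ring
    have e3 : (y0 + t * D 0 - t * D 0) * (P 0 - D 0) + (y1 + t * D 1 - t * D 1) * (P 1 - D 1)
        - 1 * (u 0 * P 0 + u 1 * P 1 + k) =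
        (y0 - u 0) * (P 0 - D 0) + (y1 - u 1) * (P 1 - D 1) - e := by
      linear_combination -he
    rw [← sub_eq_zero, iff_comm, ← sub_eq_zero, e3]
    constructor <;> intro hl
    · apply mul_left_cancel₀ hk
      linear_combination (f0 ^ 2 + f1 ^ 2) * hl - (P 0 - D 0) * e1 - (P 1 - D 1) * e2
        + e * f0 * hf0 + e * f1 * hf1
    · apply mul_left_cancel₀ hN
      linear_combination e * hl + (P 0 - D 0) * e1 + (P 1 - D 1) * e2
        - e * f0 * hf0 - e * f1 * hf1

end Tangent

/-! ### Thales circles and pedal triangles -/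

theorem mem_ofDiameter_iff (P D X : Plane) : X ∈ EuclideanGeometry.Sphere.ofDiameter P D ↔
    (P 0 - X 0) * (X 0 - D 0) + (P 1 - X 1) * (X 1 - D 1) = 0 := by
  have h : 0 ≤ (EuclideanGeometry.Sphere.ofDiameter P D).radius := by
    rw [EuclideanGeometry.Sphere.ofDiameter]; positivity
  rw [mem_sphere_iff_sq h, EuclideanGeometry.Sphere.ofDiameter, div_pow, plane_dist_sq]
  simp only [midpoint_eq_smul_add, PiLp.smul_apply, PiLp.add_apply, smul_eq_mul, invOf_eq_inv]
  constructor <;> intro h <;> linear_combination -h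

/-- By Thales the angle at `X` is right. In the limiting case `X = P` the tangent is perpendicular
to the diameter `PD`, so both cases give the same perpendicular. -/
theorem isPerpAt_lineFrom {D P X : Plane} (hX : X ∈ EuclideanGeometry.Sphere.ofDiameter P D)
    (hXD : X ≠ D) : IsPerpAt D X (lineFrom D P X) := by
  rw [mem_ofDiameter_iff] at hX
  by_cases h : X = P
  · subst h
    rw [lineFrom, if_pos rfl]
    intro Q
    rw [EuclideanGeometry.Sphere.mem_orthRadius_iff_inner_left, plane_inner,
      EuclideanGeometry.Sphere.ofDiameter]
    simp only [vsub_eq_sub, PiLp.sub_apply, midpoint_eq_smul_add, PiLp.smul_apply,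
      PiLp.add_apply, smul_eq_mul, invOf_eq_inv]
    constructor <;> intro h
    · linear_combination 2 * h
    · linear_combination h / 2
  · rw [lineFrom, if_neg h]
    have hf : X = footOn D P X :=
      (eq_footOn_iff X).2 ⟨right_mem_affineSpan_pair ℝ P X, by linear_combination -hX⟩
    have hl := IsPerpAt.line_footOn (D := D) (Ne.symm h) (hf ▸ hXD)
    rwa [← hf] at hl

/-- Three noncollinear points determine the affine functionals vanishing on them. -/
theorem AffineIndependent.eq_zero_of_forall {p : Fin 3 → Plane} (hp : AffineIndependent ℝ p)
    {a b c : ℝ} (h : ∀ i, a * p i 0 + b * p i 1 + c = 0) : a = 0 ∧ b = 0 ∧ c = 0 := by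
  by_cases hab : a ^ 2 + b ^ 2 = 0
  · have ha : a = 0 := by nlinarith
    have hb : b = 0 := by nlinarith
    refine ⟨ha, hb, ?_⟩
    have := h 0
    rwa [ha, hb, zero_mul, zero_mul, zero_add, zero_add] at this
  · exfalso
    rw [affineIndependent_iff_not_collinear] at hp
    apply hp
    rw [collinear_iff_of_mem (Set.mem_range_self (0 : Fin 3))]
    refine ⟨!₂[-b, a], ?_⟩
    rintro _ ⟨i, rfl⟩
    refine ⟨((p i 1 - p 0 1) * a - (p i 0 - p 0 0) * b) / (a ^ 2 + b ^ 2), ?_⟩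
    have h0 := h 0
    have hi := h i
    apply plane_ext
    · simp
      field_simp
      linear_combination a * (hi - h0)
    · simp
      field_simp
      linear_combination b * (hi - h0)

section Pedal

variable {D : Plane} {E : EuclideanGeometry.Sphere Plane} {T : Affine.Triangle ℝ Plane}

theorem Affine.Simplex.circumsphere_eq_of_forall_mem (hT : ∀ i, T.points i ∈ E) :
    T.circumsphere = E := by
  symm
  apply T.circumsphere_unique_dist_eq.2
  refine ⟨?_, by rintro _ ⟨i, rfl⟩; exact hT i⟩
  rw [T.independent.affineSpan_eq_top_iff_card_eq_finrank_add_one.2 (by simp)]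
  exact AffineSubspace.mem_top _ _ _

theorem points_notMem_sideLine (T : Affine.Triangle ℝ Plane) (i : Fin 3) :
    T.points i ∉ sideLine T i := by
  intro h
  have hne : i ≠ i + 1 ∧ i ≠ i + 2 ∧ i + 1 ≠ i + 2 := by fin_cases i <;> decide
  exact (affineIndependent_iff_not_collinear_of_ne hne.1 hne.2.1 hne.2.2).1 T.independent
    (collinear_insert_of_mem_affineSpan_pair h)

theorem points_mem_sideLine {i j : Fin 3} (T : Affine.Triangle ℝ Plane) (hij : i ≠ j) :
    T.points i ∈ sideLine T j := by
  have : i = j + 1 ∨ i = j + 2 := by revert i j; decide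
  rcases this with rfl | rfl
  · exact left_mem_affineSpan_pair ℝ _ _
  · exact right_mem_affineSpan_pair ℝ _ _

theorem points_add_one_ne_add_two (T : Affine.Triangle ℝ Plane) (i : Fin 3) :
    T.points (i + 1) ≠ T.points (i + 2) :=
  T.independent.injective.ne (by revert i; decide)

theorem isPedalCircle_iff (hD : D ∉ E) :
    IsPedalCircle D T E ↔ ∀ i, footOn D (T.points (i + 1)) (T.points (i + 2)) ∈ E := by
  constructor
  · rintro ⟨h, rfl⟩ i
    exact (Affine.Simplex.mk (n := 2) (pedalPoints D T) h).mem_circumsphere i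
  · intro h
    -- A common foot, being different from `D`, would make two side lines equal, putting a vertex on
    -- its opposite side. Distinct points of a circle are then affinely independent.
    have hinj : Function.Injective (pedalPoints D T) := by
      intro i j hij
      by_contra hne
      have hl : ∀ i, IsPerpAt D (pedalPoints D T i) (sideLine T i) := fun i =>
        IsPerpAt.line_footOn (points_add_one_ne_add_two T i) fun h' => hD (h' ▸ h i)
      have hi := hl i
      rw [hij] at hi
      exact points_notMem_sideLine T i (hi.eq (hl j) ▸ points_mem_sideLine T hne)
    have hind : AffineIndependent ℝ (pedalPoints D T) :=
      E.cospherical.affineIndependent (by rintro _ ⟨i, rfl⟩; exact h i) hinj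
    exact ⟨hind, Affine.Simplex.circumsphere_eq_of_forall_mem h⟩

end Pedal

/-! ### Conics correspond to pedal circles -/

section Inconic

variable {D : Plane} {E : EuclideanGeometry.Sphere Plane}

/-- A sphere not passing through `D` is the pedal curve of a conic with focus `D`. -/
theorem exists_focusMatrix_pedalEq_iff (hr : 0 < E.radius) (hD : D ∉ E) :
    ∃ (u : Plane) (k : ℝ), u 0 * D 0 + u 1 * D 1 + k ≠ 0 ∧
      ∀ X, PedalEq D u (u 0 * D 0 + u 1 * D 1 + k) X ↔ X ∈ E := by
  rw [mem_sphere_iff_sq hr.le] at hD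
  obtain ⟨w, hw⟩ : ∃ w, w = (D 0 - E.center 0) ^ 2 + (D 1 - E.center 1) ^ 2 - E.radius ^ 2 :=
    ⟨_, rfl⟩
  have hw0 : w ≠ 0 := by rw [hw]; exact sub_ne_zero.2 hD
  -- `E` is to be the auxiliary circle of the conic: the eccentricity is the distance from `D` to
  -- its centre over its radius, and `e` is the power `w` of `D` over the radius.
  obtain ⟨u, hu⟩ : ∃ u : Plane, u =
    !₂[(D 0 - E.center 0) / E.radius, (D 1 - E.center 1) / E.radius] := ⟨_, rfl⟩
  have hu0 : u 0 = (D 0 - E.center 0) / E.radius := by rw [hu]; simp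
  have hu1 : u 1 = (D 1 - E.center 1) / E.radius := by rw [hu]; simp
  refine ⟨u, w / E.radius - u 0 * D 0 - u 1 * D 1, ?_, fun X => ?_⟩
  · rw [show u 0 * D 0 + u 1 * D 1 + (w / E.radius - u 0 * D 0 - u 1 * D 1) = w / E.radius by ring]
    exact div_ne_zero hw0 hr.ne'
  · rw [show u 0 * D 0 + u 1 * D 1 + (w / E.radius - u 0 * D 0 - u 1 * D 1) = w / E.radius by ring,
      mem_sphere_iff_sq hr.le, PedalEq, hu0, hu1]
    have hr0 := hr.ne'
    field_simp
    rw [← sub_eq_zero, iff_comm, ← sub_eq_zero]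
    constructor
    · intro h
      linear_combination w * h - ((X 0 - D 0) ^ 2 + (X 1 - D 1) ^ 2 - w) * hw
    · intro h
      apply mul_left_cancel₀ hw0
      linear_combination h + ((X 0 - D 0) ^ 2 + (X 1 - D 1) ^ 2 - w) * hw

/-- Subtracting `1 - |u|²` times the circle equation from the pedal equation cancels the quadratic
terms. The remaining affine function vanishes at three noncollinear points, so its coefficients are
zero. -/
theorem PedalEq.eq_of_forall_mem {p : Fin 3 → Plane} (hr : 0 ≤ E.radius)
    (hp : AffineIndependent ℝ p) (hE : ∀ i, p i ∈ E) {u : Plane} {e : ℝ}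
    (hu : ∀ i, PedalEq D u e (p i)) :
    e * u 0 = (1 - u 0 ^ 2 - u 1 ^ 2) * (E.center 0 - D 0) ∧
    e * u 1 = (1 - u 0 ^ 2 - u 1 ^ 2) * (E.center 1 - D 1) ∧
    e ^ 2 = (1 - u 0 ^ 2 - u 1 ^ 2) *
      (E.radius ^ 2 - (E.center 0 - D 0) ^ 2 - (E.center 1 - D 1) ^ 2) := by
  obtain ⟨δ, hδ⟩ : ∃ δ, δ = 1 - u 0 ^ 2 - u 1 ^ 2 := ⟨_, rfl⟩
  obtain ⟨h0, h1, h2⟩ := hp.eq_zero_of_forall (a := e * u 0 - δ * (E.center 0 - D 0))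
    (b := e * u 1 - δ * (E.center 1 - D 1))
    (c := (e ^ 2 - δ * (E.radius ^ 2 - (E.center 0 - D 0) ^ 2 - (E.center 1 - D 1) ^ 2)) / 2
      - (e * u 0 - δ * (E.center 0 - D 0)) * D 0 - (e * u 1 - δ * (E.center 1 - D 1)) * D 1)
    (fun i => by
      have h := hu i
      have h' := (mem_sphere_iff_sq hr _).1 (hE i)
      unfold PedalEq at h
      rw [← hδ] at h
      linear_combination h / 2 + δ / 2 * h')
  rw [← hδ]
  exact ⟨by linear_combination h0, by linear_combination h1,
    by linear_combination 2 * h2 + 2 * D 0 * h0 + 2 * D 1 * h1⟩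

/-- Two conics with focus `D` whose pedal curves contain the same noncollinear points of a
sphere are equal. -/
theorem focusMatrix_eq_of_pedalEq (hr : 0 < E.radius) {p : Fin 3 → Plane}
    (hp : AffineIndependent ℝ p) (hE : ∀ i, p i ∈ E) {u v : Plane} {k l : ℝ}
    (hk : u 0 * D 0 + u 1 * D 1 + k ≠ 0) (hl : v 0 * D 0 + v 1 * D 1 + l ≠ 0)
    (hu : ∀ i, PedalEq D u (u 0 * D 0 + u 1 * D 1 + k) (p i))
    (hv : ∀ i, PedalEq D v (v 0 * D 0 + v 1 * D 1 + l) (p i)) :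
    focusMatrix D u k = focusMatrix D v l := by
  obtain ⟨hu0, hu1, hu2⟩ := PedalEq.eq_of_forall_mem hr.le hp hE hu
  obtain ⟨hv0, hv1, hv2⟩ := PedalEq.eq_of_forall_mem hr.le hp hE hv
  generalize he : u 0 * D 0 + u 1 * D 1 + k = e at *
  generalize hf : v 0 * D 0 + v 1 * D 1 + l = f at *
  obtain ⟨δ, hδ⟩ : ∃ δ, δ = 1 - u 0 ^ 2 - u 1 ^ 2 := ⟨_, rfl⟩
  obtain ⟨ε, hε⟩ : ∃ ε, ε = 1 - v 0 ^ 2 - v 1 ^ 2 := ⟨_, rfl⟩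
  rw [← hδ] at hu0 hu1 hu2
  rw [← hε] at hv0 hv1 hv2
  generalize E.center 0 - D 0 = m at *
  generalize E.center 1 - D 1 = n at *
  -- Parabolas, `δ = 0`, are excluded: their pedal curve is a line.
  have hδ0 : δ ≠ 0 := by rintro rfl; simp [hk] at hu2
  have hε0 : ε ≠ 0 := by rintro rfl; simp [hl] at hv2
  have key : ∀ {x y e δ : ℝ}, δ = 1 - x ^ 2 - y ^ 2 → e * x = δ * m → e * y = δ * n →
      e ^ 2 = δ * (E.radius ^ 2 - m ^ 2 - n ^ 2) → e ^ 2 = δ ^ 2 * E.radius ^ 2 := by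
    intro x y e δ h0 h1 h2 h3
    linear_combination (-e ^ 2) * h0 + (e * x + δ * m) * h1 + (e * y + δ * n) * h2 + δ * h3
  have k1 := key hδ hu0 hu1 hu2
  have k2 := key hε hv0 hv1 hv2
  have hδε : δ = ε := by
    have h1 : δ * E.radius ^ 2 = E.radius ^ 2 - m ^ 2 - n ^ 2 :=
      mul_left_cancel₀ hδ0 (by linear_combination hu2 - k1)
    have h2 : ε * E.radius ^ 2 = E.radius ^ 2 - m ^ 2 - n ^ 2 :=
      mul_left_cancel₀ hε0 (by linear_combination hv2 - k2)
    exact mul_right_cancel₀ (pow_ne_zero 2 hr.ne') (h1.trans h2.symm)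
  rw [← hδε] at hv0 hv1 k2
  -- Only the sign of `e` is undetermined, and changing it replaces `(u, k)` by `(-u, -k)`, which
  -- has the same matrix.
  rcases sq_eq_sq_iff_eq_or_eq_neg.1 (k1.trans k2.symm) with h | h
  · have h0 : u 0 = v 0 := mul_left_cancel₀ hk (by rw [hu0, h, hv0])
    have h1 : u 1 = v 1 := mul_left_cancel₀ hk (by rw [hu1, h, hv1])
    have h2 : k = l := by rw [← he, ← hf, h0, h1] at h; linarith
    rw [plane_ext h0 h1, h2]
  · have h0 : u 0 = (-v) 0 := mul_left_cancel₀ hk (by rw [hu0, h, PiLp.neg_apply]; linarith)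
    have h1 : u 1 = (-v) 1 := mul_left_cancel₀ hk (by rw [hu1, h, PiLp.neg_apply]; linarith)
    have h2 : k = -l := by
      rw [← he, ← hf, h0, h1, PiLp.neg_apply, PiLp.neg_apply] at h; linarith
    rw [plane_ext h0 h1, h2, focusMatrix_neg]

theorem Conic.isTangentLine_iff_exists_isPerpAt {γ : Conic} {u : Plane} {c k : ℝ} (hc : c ≠ 0)
    (h : γ.mat = c • focusMatrix D u k) (hk : u 0 * D 0 + u 1 * D 1 + k ≠ 0) (hD : D ∉ E)
    (hE : ∀ X, PedalEq D u (u 0 * D 0 + u 1 * D 1 + k) X ↔ X ∈ E)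
    {ℓ : AffineSubspace ℝ Plane} {A : Plane} (hA : A ∈ ℓ) :
    γ.IsTangentLine ℓ ↔ ∃ X ∈ E, IsPerpAt D X ℓ := by
  constructor
  · intro hℓ
    obtain ⟨X, -, hX, hp⟩ := hℓ.exists_isPerpAt hc h hk hA
    exact ⟨X, (hE X).1 hp, hX⟩
  · rintro ⟨X, hX, hp⟩
    exact Conic.isTangentLine_of_isPerpAt hc h hk (fun h' => hD (h' ▸ hX)) hp ((hE X).2 hX)

end Inconic

/-! ### Closing up the triangle -/

section Chords

variable {D P Q R X Y : Plane} {C E : EuclideanGeometry.Sphere Plane}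
  {ℓ₁ ℓ₂ : AffineSubspace ℝ Plane}

theorem IsPerpAt.footOn_eq_of_mem {ℓ : AffineSubspace ℝ Plane} (h : IsPerpAt D X ℓ) (hX : X ≠ D)
    (hPQ : P ≠ Q) (hP : P ∈ ℓ) (hQ : Q ∈ ℓ) : footOn D P Q = X := by
  rw [h.eq_line hX hPQ hP hQ] at h
  exact IsPerpAt.footOn_eq h

theorem footOn_mem_iff_exists_isPerpAt (hD : D ∉ E) (hPQ : P ≠ Q) :
    footOn D P Q ∈ E ↔ ∃ X ∈ E, IsPerpAt D X line[ℝ, P, Q] := by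
  constructor
  · intro h
    exact ⟨_, h, IsPerpAt.line_footOn hPQ fun h' => hD (h' ▸ h)⟩
  · rintro ⟨X, hX, h⟩
    rwa [IsPerpAt.footOn_eq h]

/-- If the chords of `C` with feet on `E` close up, then two different such chords `PQ` and `PR`
form a triangle all of whose feet lie on `E`. -/
theorem exists_triangle_of_isPerpAt (hD : D ∉ E)
    (hclose : ∀ P Q R : Plane, P ∈ C → Q ∈ C → R ∈ C → P ≠ Q → P ≠ R → Q ≠ R →
      footOn D P Q ∈ E → footOn D P R ∈ E → footOn D Q R ∈ E)
    (hP : P ∈ C) (hQ : Q ∈ C) (hR : R ∈ C) (hX : X ∈ E) (hY : Y ∈ E)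
    (h₁ : IsPerpAt D X ℓ₁) (h₂ : IsPerpAt D Y ℓ₂) (hne : ℓ₁ ≠ ℓ₂)
    (hP₁ : P ∈ ℓ₁) (hP₂ : P ∈ ℓ₂) (hQ₁ : Q ∈ ℓ₁) (hR₂ : R ∈ ℓ₂) (hQP : Q ≠ P) (hRP : R ≠ P) :
    Q ≠ R ∧ footOn D Q R ∈ E ∧ ∃ T : Affine.Triangle ℝ Plane, T.points = ![P, Q, R] ∧
      IsInscribedIn T C ∧ ∀ i, footOn D (T.points (i + 1)) (T.points (i + 2)) ∈ E := by
  have hXD : X ≠ D := fun h => hD (h ▸ hX)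
  have hYD : Y ≠ D := fun h => hD (h ▸ hY)
  have hQR : Q ≠ R := by
    rintro rfl
    exact hne ((h₁.eq_line hXD hQP hQ₁ hP₁).trans (h₂.eq_line hYD hQP hR₂ hP₂).symm)
  have f1 : footOn D P Q ∈ E := by rwa [h₁.footOn_eq_of_mem hXD hQP.symm hP₁ hQ₁]
  have f2 : footOn D P R ∈ E := by rwa [h₂.footOn_eq_of_mem hYD hRP.symm hP₂ hR₂]
  have f3 := hclose P Q R hP hQ hR hQP.symm hRP.symm hQR f1 f2
  refine ⟨hQR, f3, ⟨![P, Q, R], C.cospherical.affineIndependent_of_mem_of_ne hP hQ hR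
    hQP.symm hRP.symm hQR⟩, rfl, ?_, ?_⟩
  · intro i
    fin_cases i
    exacts [hP, hQ, hR]
  · intro i
    fin_cases i
    exacts [f3, footOn_comm D P R ▸ f2, f1]

end Chords

theorem mainTheorem1 (T : Affine.Triangle ℝ Plane) (D : Plane)
    (hside : ∀ i, D ∉ sideLine T i) (hcirc : D ∉ T.circumsphere) :
    ∃ (E : EuclideanGeometry.Sphere Plane) (γ : Conic),
      -- the pedal circle and the inconic with focus `D` exist, and the latter is unique
      IsPedalCircle D T E ∧
      IsInconicWithFocus γ T D ∧
      (∀ γ' : Conic, IsInconicWithFocus γ' T D → γ.Same γ') ∧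
      -- the circumcircle and the inconic are a Poncelet pair
      IsPonceletPairThree T.circumsphere γ ∧
      -- inscribed triangles share the pedal circle iff they are circumscribed to the inconic
      (∀ T' : Affine.Triangle ℝ Plane, IsInscribedIn T' T.circumsphere →
        (IsPedalCircle D T' E ↔ IsCircumscribedTo T' γ)) ∧
      -- the construction only gives such triangles
      (∀ P Q R : Plane, IsPedalConstruction T.circumsphere E D P Q R →
        γ.IsTangentLine line[ℝ, Q, R] ∧ footOn D Q R ∈ E ∧
        ∃ T' : Affine.Triangle ℝ Plane, T'.points = ![P, Q, R] ∧
          IsInscribedIn T' T.circumsphere ∧ IsCircumscribedTo T' γ ∧ IsPedalCircle D T' E) ∧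
      -- the construction gives all such triangles, from each of their vertices
      (∀ T' : Affine.Triangle ℝ Plane, IsInscribedIn T' T.circumsphere →
        IsCircumscribedTo T' γ →
        IsPedalConstruction T.circumsphere E D (T'.points 0) (T'.points 1) (T'.points 2)) := by
  obtain ⟨E, hr, hD, hfeet, hclose⟩ := exists_sphere_forall_footOn_mem T D hside hcirc
  obtain ⟨u, k, hk, hpedal⟩ := exists_focusMatrix_pedalEq_iff hr hD
  have hXD : ∀ {X}, X ∈ E → X ≠ D := fun hX h => hD (h ▸ hX)
  obtain ⟨γ, hγ⟩ : ∃ γ : Conic, γ.mat = (1 : ℝ) • focusMatrix D u k :=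
    ⟨⟨focusMatrix D u k, focusMatrix_isSymm D u k, by
      rw [det_focusMatrix]; exact neg_ne_zero.2 (pow_ne_zero 2 hk)⟩, (one_smul _ _).symm⟩
  have htan : ∀ {ℓ : AffineSubspace ℝ Plane} {A : Plane}, A ∈ ℓ →
      (γ.IsTangentLine ℓ ↔ ∃ X ∈ E, IsPerpAt D X ℓ) := fun hA =>
    Conic.isTangentLine_iff_exists_isPerpAt one_ne_zero hγ hk hD hpedal hA
  have hline : ∀ {A B : Plane}, A ≠ B → (γ.IsTangentLine line[ℝ, A, B] ↔ footOn D A B ∈ E) :=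
    fun hAB => (htan (left_mem_affineSpan_pair ℝ _ _)).trans
      (footOn_mem_iff_exists_isPerpAt hD hAB).symm
  have hcircum : ∀ T' : Affine.Triangle ℝ Plane, IsCircumscribedTo T' γ ↔
      ∀ i, footOn D (T'.points (i + 1)) (T'.points (i + 2)) ∈ E := fun T' =>
    forall_congr' fun i => hline (points_add_one_ne_add_two T' i)
  have hpc := (isPedalCircle_iff (T := T) hD).2 hfeet
  refine ⟨E, γ, hpc, ⟨Conic.isFocus_iff.2 ⟨1, u, k, one_ne_zero, hk, hγ⟩, (hcircum T).2 hfeet⟩,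
    ?_, ⟨⟨T, T.mem_circumsphere, (hcircum T).2 hfeet⟩, ?_⟩, ?_, ?_, ?_⟩
  · rintro γ' ⟨hf, hc⟩
    obtain ⟨c, v, l, hc0, hl, hγ'⟩ := Conic.isFocus_iff.1 hf
    obtain ⟨hind, -⟩ := hpc
    -- The sides of `T` are tangent to `γ'`, so the three feet lie on the pedal curve of `γ'` as
    -- well.
    have hv : ∀ i, PedalEq D v (v 0 * D 0 + v 1 * D 1 + l) (pedalPoints D T i) := by
      intro i
      obtain ⟨X, hX, hp, he⟩ := (hc i).exists_isPerpAt hc0 hγ' hl (left_mem_affineSpan_pair ℝ _ _)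
      rwa [pedalPoints, IsPerpAt.footOn_eq hp]
    refine ⟨c, hc0, ?_⟩
    rw [hγ', hγ, one_smul, focusMatrix_eq_of_pedalEq hr hind hfeet hk hl
      (fun i => (hpedal _).2 (hfeet i)) hv]
  · intro P Q R ℓ₁ ℓ₂ hP hQ hR h₁ h₂ hne hP₁ hP₂ hQ₁ hR₂ hQP hRP
    obtain ⟨X, hX, hX'⟩ := (htan hP₁).1 h₁
    obtain ⟨Y, hY, hY'⟩ := (htan hP₂).1 h₂
    obtain ⟨-, -, T', hT', -, hf⟩ := exists_triangle_of_isPerpAt hD hclose hP hQ hR hX hY hX' hY'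
      hne hP₁ hP₂ hQ₁ hR₂ hQP hRP
    exact ⟨T', hT', (hcircum T').2 hf⟩
  · intro T' _
    rw [isPedalCircle_iff hD, hcircum]
  · rintro P Q R ⟨hP, X, Y, hXY, hX, hX', hY, hY', hQ, hQP, hQ₁, hR, hRP, hR₂⟩
    have h₁ := isPerpAt_lineFrom hX' (hXD hX)
    have h₂ := isPerpAt_lineFrom hY' (hXD hY)
    rw [mem_ofDiameter_iff] at hX' hY'
    -- The two lines differ because a line determines its foot and `X ≠ Y`.
    obtain ⟨hQR, hf, T', hT', hin, hf'⟩ := exists_triangle_of_isPerpAt hD hclose hP hQ hR hX hY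
      h₁ h₂ (fun h => hXY (h₁.unique (h ▸ h₂))) ((h₁ P).2 hX') ((h₂ P).2 hY') hQ₁ hR₂ hQP hRP
    exact ⟨(hline hQR).2 hf, hf, T', hT', hin, (hcircum T').2 hf', (isPedalCircle_iff hD).2 hf'⟩
  · intro T' hT' hc
    have hf := (hcircum T').1 hc
    have hp : ∀ i, IsPerpAt D (pedalPoints D T' i) (sideLine T' i) := fun i =>
      IsPerpAt.line_footOn (points_add_one_ne_add_two T' i) (hXD (hf i))
    have hmem : ∀ i j, i ≠ j → pedalPoints D T' j ∈
        EuclideanGeometry.Sphere.ofDiameter (T'.points i) D := fun i j hij =>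
      (mem_ofDiameter_iff _ _ _).2 ((hp j _).1 (points_mem_sideLine T' hij))
    have hlf : ∀ i j, i ≠ j → lineFrom D (T'.points i) (pedalPoints D T' j) = sideLine T' j :=
      fun i j hij => (isPerpAt_lineFrom (hmem i j hij) (hXD (hf j))).eq (hp j)
    obtain ⟨hind, -⟩ := (isPedalCircle_iff hD).2 hf
    -- Side lines are indexed by the opposite vertex, so the line from vertex 0 to vertex 1 carries
    -- foot 2, and the line to vertex 2 carries foot 1.
    refine ⟨hT' 0, pedalPoints D T' 2, pedalPoints D T' 1, hind.injective.ne (by decide),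
      hf 2, hmem 0 2 (by decide), hf 1, hmem 0 1 (by decide),
      hT' 1, T'.independent.injective.ne (by decide), ?_,
      hT' 2, T'.independent.injective.ne (by decide), ?_⟩
    · rw [hlf 0 2 (by decide)]; exact points_mem_sideLine T' (by decide)
    · rw [hlf 0 1 (by decide)]; exact points_mem_sideLine T' (by decide)
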